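/- Let $d\ge 2$. For a unit vector $\psi=\sum_{i,j}A_{ij}\,|i\rangle\otimes|j\rangle\in\mathbb C^d\otimes\mathbb C^d$ let $\vec\lambda=(\lambda_1,\dots,\lambda_d)$ be its vector of Schmidt coefficients, i.e. the eigenvalues of $AA^\dagger$, so that $\psi=\sum_i\sqrt{\lambda_i}\,e_i\otimes f_i$ for some orthonormal bases. For $1\le k\le d$ the $k$-th generalized concurrence is $$C_k(\psi)=\frac{d}{\binom dk^{1/k}}\,S_k(\vec\lambda)^{1/k},$$ where $S_k$ is the $k$-th elementary symmetric polynomial in $d$ variables. The convex roof of a function $E$ on pure states is $$\widehat E(\rho)=\inf\Bigl\{\sum_i p_iE(\psi_i)\;:\;\rho=\sum_ip_i|\psi_i\rangle\langle\psi_i|,\ \|\psi_i\|=1,\ p_i\ge0,\ \sum_ip_i=1\Bigr\}$$ (finite sums). Let $\Phi_d=\frac1d\sum_{i,j=1}^d|ii\rangle\langle jj|$, and for $b\in[0,1]$ let $\rho_{\rm iso}(b)=b\,\Phi_d+(1-b)\frac{\mathbb 1-\Phi_d}{d^2-1}$ be the isotropic state. Further let $E_{\rm iso}(b)=\inf\{E(\psi):\|\psi\|=1,\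 \langle\psi|\Phi_d|\psi\rangle=b\}$, and let $\widehat{E_{\rm iso}}(b)=\inf\{\sum_ip_iE_{\rm iso}(b_i): b_i\in[0,1],\ p_i\ge0,\ \sum_ip_i=1,\ \sum_ip_ib_i=b\}$ (finite sums) be the convex roof of $E_{\rm iso}$ on $[0,1]$. Then for all $b\in[0,1]$ $$\widehat{C_2}(\rho_{\rm iso}(b))=\widehat{C_{2,\rm iso}}(b)=\begin{cases}0,&0\le b\le\frac1d,\\[2pt]\dfrac{db-1}{d-1},&\frac1d\le b\le1,\end{cases}$$ and $$\widehat{C_d}(\rho_{\rm iso}(b))=\widehat{C_{d,\rm iso}}(b)=\begin{cases}0,&0\le b\le1-\frac1d,\\[2pt]db-d+1,&1-\frac1d\le b\le1.\end{cases}$$ -/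

import Mathlib

/-- The convex roof: `pt` sends a parameter in `S` to a point of the real vector space `V`, and
`f` is a function of the parameter. The value at `x` is the infimum of `∑ i, p i * f (y i)` over
all finite convex combinations `∑ i, p i • pt (y i) = x` with all `y i` in `S`;
it is `⊤` if there is no such combination. -/
noncomputable def convexRoof {X V : Type*} [AddCommGroup V] [Module ℝ V]
    (S : Set X) (pt : X → V) (f : X → ℝ) (x : V) : EReal :=
  sInf {c : EReal | ∃ (n : ℕ) (p : Fin n → ℝ) (y : Fin n → X),
    (∀ i, 0 ≤ p i) ∧ ∑ i, p i = 1 ∧ (∀ i, y i ∈ S) ∧ ∑ i, p i • pt (y i) = x ∧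
      c = ((∑ i, p i * f (y i) : ℝ) : EReal)}

/-- Vectors of the bipartite space `ℂ^d ⊗ ℂ^d`, by their coordinates in the product basis. -/
abbrev BipartiteVec (d : ℕ) : Type := EuclideanSpace ℂ (Fin d × Fin d)

/-- Operators on `ℂ^d ⊗ ℂ^d`, as matrices in the product basis. -/
abbrev BipartiteOp (d : ℕ) : Type := Matrix (Fin d × Fin d) (Fin d × Fin d) ℂ

/-- The unit vectors of `ℂ^d ⊗ ℂ^d`. -/
def unitVecs (d : ℕ) : Set (BipartiteVec d) := {ψ | ‖ψ‖ = 1}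

/-- The rank-one operator `|ψ⟩⟨ψ|`. -/
def ketBra {d : ℕ} (ψ : BipartiteVec d) : BipartiteOp d :=
  Matrix.of fun a b => ψ a * star (ψ b)

/-- The coefficient matrix `A` of `ψ = ∑ i j, A i j |i j⟩`. -/
def coeffMatrix {d : ℕ} (ψ : BipartiteVec d) : Matrix (Fin d) (Fin d) ℂ :=
  Matrix.of fun i j => ψ (i, j)

/-- The Schmidt vector `λ` of `ψ`: the eigenvalues, with multiplicity and in decreasing order, of
the reduced density matrix `A Aᴴ = Tr₂ |ψ⟩⟨ψ|`. These are the squared singular values of `A`, so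
that `ψ = ∑ i, √(λ i) eᵢ ⊗ fᵢ` for suitable orthonormal bases `e` and `f`. -/
noncomputable def schmidtVector {d : ℕ} (ψ : BipartiteVec d) : Fin d → ℝ :=
  (Matrix.isHermitian_mul_conjTranspose_self (coeffMatrix ψ)).eigenvalues

/-- The `k`-th generalized concurrence of a vector,
`C_k(λ) = d / (d choose k)^(1/k) * S_k(λ)^(1/k)`, with `S_k` the elementary symmetric polynomial. -/
noncomputable def genConcurrenceVec (d k : ℕ) (lam : Fin d → ℝ) : ℝ :=
  (d : ℝ) / ((d.choose k : ℕ) : ℝ) ^ (1 / (k : ℝ)) *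
    (MvPolynomial.eval lam (MvPolynomial.esymm (Fin d) ℝ k)) ^ (1 / (k : ℝ))

/-- The `k`-th generalized concurrence of a bipartite pure state. -/
noncomputable def genConcurrence (d k : ℕ) (ψ : BipartiteVec d) : ℝ :=
  genConcurrenceVec d k (schmidtVector ψ)

/-- The projection `Φ_d = (1/d) ∑ i j, |i i⟩⟨j j|` onto the maximally entangled state. -/
noncomputable def maxEntProj (d : ℕ) : BipartiteOp d :=
  (1 / (d : ℂ)) • ∑ i : Fin d, ∑ j : Fin d, Matrix.single (i, i) (j, j) (1 : ℂ)

/-- The isotropic state `b Φ_d + (1 - b) (1 - Φ_d) / (d² - 1)`. -/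
noncomputable def isotropicState (d : ℕ) (b : ℝ) : BipartiteOp d :=
  (b : ℂ) • maxEntProj d + (((1 - b) / ((d : ℝ) ^ 2 - 1) : ℝ) : ℂ) • (1 - maxEntProj d)

/-- The expectation value `⟨ψ|Φ_d|ψ⟩`. -/
noncomputable def overlapMaxEnt {d : ℕ} (ψ : BipartiteVec d) : ℂ :=
  star ψ.ofLp ⬝ᵥ (maxEntProj d).mulVec ψ.ofLp

/-- The convex roof of a function `E` on pure states, evaluated at an operator `ρ`: the infimum of
`∑ i, p i * E (ψ i)` over all pure state decompositions `ρ = ∑ i, p i |ψ i⟩⟨ψ i|`. -/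
noncomputable def stateRoof {d : ℕ} (E : BipartiteVec d → ℝ) (ρ : BipartiteOp d) : EReal :=
  convexRoof (unitVecs d) ketBra E ρ

/-- `E_iso(b)`: the smallest value of `E` on pure states `ψ` with `⟨ψ|Φ_d|ψ⟩ = b`. -/
noncomputable def isoMin {d : ℕ} (E : BipartiteVec d → ℝ) (b : ℝ) : ℝ :=
  sInf {e : ℝ | ∃ ψ ∈ unitVecs d, overlapMaxEnt ψ = (b : ℂ) ∧ E ψ = e}

/-- The convex roof over the interval `[0, 1]` of the one-variable function `E_iso`. -/
noncomputable def isoMinRoof {d : ℕ} (E : BipartiteVec d → ℝ) (b : ℝ) : EReal :=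
  convexRoof (Set.Icc (0 : ℝ) 1) id (isoMin E) b

/-!
Let `A` be the coefficient matrix of a unit vector `ψ` and `λ` its Schmidt vector. The overlap of
`ψ` with the maximally entangled state is `|tr A|² / d`, and `|tr A| ≤ ∑ √λᵢ`
(`norm_trace_coeffMatrix_le`).

*Lower bounds.* For both concurrences an affine function of the overlap bounds the concurrence of
pure states from below. For `C_2` it follows from `(∑ √λᵢ)² = 1 + 2 ∑_{i<j} √λᵢ √λⱼ` and the
Cauchy-Schwarz inequality over pairs (`le_genConcurrenceVec_two`); for `C_d` it is Kober's
inequality `(∑ √λᵢ)² ≤ (d - 1) ∑ λᵢ + d (∏ λᵢ)^(1/d)` (`sq_sum_sqrt_le_kober`). Both concurrences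
are also nonnegative. Affine lower bounds pass to convex roofs, and the roof over `[0, 1]` lies
below the roof over states because a decomposition of the isotropic state yields, by taking
overlaps, a decomposition of `b` (`isoMinRoof_le_stateRoof`).

*Upper bounds.* It remains to attain these bounds by decompositions of the isotropic states
(`roofs_eq_of_mem_roofHull`), and by convexity only at the kinks. At `b = 1` the state is pure and
maximally entangled. At `b = 0` and at the kink `b = 1/d` (for `C_2`) or `b = 1 - 1/d` (for `C_d`) a
mixture of vectors of Schmidt rank less than `k` is needed, since these have `C_k = 0`. It is the
orbit of one vector under the unitaries `U ⊗ Ū`, where `U` runs over the finite group of monomial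
matrices with fourth roots of unity as entries. This group is too small to make every orbit average
isotropic, but it does so as soon as `(d + 1) ∑ |A i i|² = 1 + |tr A|²`
(`twirl_eq_isotropicState`), a condition met by suitable real `A` of rank one, and of rank `d - 1`.
-/

/-! ### Inequalities for elementary symmetric polynomials -/

open Finset in
/-- Jensen's inequality for `u ↦ exp (2 u) - 2 a exp u`, which lies above its tangent at the mean
of the `log (s i)` as soon as `a` is at most the geometric mean. -/
theorem card_mul_geomMean_le_sum_sq_sub {ι : Type*} (t : Finset ι) (s : ι → ℝ)
    (hs : ∀ i ∈ t, 0 < s i) {a g : ℝ} (hg : 0 < g) (hag : a ≤ g)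
    (hlog : ∑ i ∈ t, Real.log (s i) = #t * Real.log g) :
    #t * (g ^ 2 - 2 * a * g) ≤ ∑ i ∈ t, s i ^ 2 - 2 * a * ∑ i ∈ t, s i := by
  have key : ∀ i ∈ t, (g ^ 2 - 2 * a * g) + (2 * g ^ 2 - 2 * a * g) *
      (Real.log (s i) - Real.log g) ≤ s i ^ 2 - 2 * a * s i := by
    intro i hi
    have h := Real.log_le_sub_one_of_pos (div_pos (hs i hi) hg)
    rw [Real.log_div (hs i hi).ne' hg.ne'] at h
    have h2 : g * (Real.log (s i) - Real.log g) ≤ s i - g := by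
      have := mul_le_mul_of_nonneg_left h hg.le
      have e : g * (s i / g - 1) = s i - g := by field_simp
      linarith
    nlinarith [sq_nonneg (s i - g), mul_le_mul_of_nonneg_left h2 (sub_nonneg.2 hag)]
  have hsum := Finset.sum_le_sum key
  simp only [sum_add_distrib, sum_sub_distrib, ← mul_sum, sum_const, nsmul_eq_mul, hlog] at hsum
  linarith

/-- The weighted arithmetic-geometric mean inequality, with weights `(m - 1) / (2 m)` and
`(m + 1) / (2 m)`. -/
theorem two_mul_mul_exp_le {m a : ℝ} (hm : 1 ≤ m) (ha : 0 < a) (L : ℝ) :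
    2 * m * (a * Real.exp (L / m)) ≤
      (m - 1) * a ^ 2 + (m + 1) * Real.exp ((Real.log a + L) / (m + 1)) ^ 2 := by
  have hm0 : 0 < m := by linarith
  have hc := convexOn_exp.2 (Set.mem_univ (2 * Real.log a))
    (Set.mem_univ (2 * ((Real.log a + L) / (m + 1))))
    (show 0 ≤ (m - 1) / (2 * m) by apply div_nonneg <;> linarith)
    (show 0 ≤ (m + 1) / (2 * m) by positivity) (by field_simp; ring)
  have e1 : (m - 1) / (2 * m) * (2 * Real.log a) + (m + 1) / (2 * m) *
      (2 * ((Real.log a + L) / (m + 1))) = Real.log a + L / m := by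
    field_simp; ring
  have e2 : ∀ x : ℝ, Real.exp (2 * x) = Real.exp x ^ 2 := fun x => by
    rw [← Real.exp_nat_mul]; norm_num
  simp only [smul_eq_mul] at hc
  rw [e1, e2, e2, Real.exp_add, Real.exp_log ha] at hc
  have := mul_le_mul_of_nonneg_left hc (by positivity : (0 : ℝ) ≤ 2 * m)
  calc 2 * m * (a * Real.exp (L / m)) ≤ _ := this
    _ = _ := by field_simp

open Finset in
/-- Kober's inequality for positive numbers `s i`, where `exp ((∑ i, log (s i)) / n)` is their
geometric mean. The induction removes a smallest element. -/
theorem sq_sum_le_kober_of_pos {ι : Type*} (t : Finset ι) (s : ι → ℝ) (hs : ∀ i ∈ t, 0 < s i) :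
    (∑ i ∈ t, s i) ^ 2 ≤ (#t - 1) * ∑ i ∈ t, s i ^ 2 +
      #t * Real.exp ((∑ i ∈ t, Real.log (s i)) / #t) ^ 2 := by
  classical
  induction t using Finset.induction_on_min_value s with
  | empty => simp
  | insert a t hat hmin ih =>
    have ha : 0 < s a := hs a (mem_insert_self a t)
    have hst : ∀ i ∈ t, 0 < s i := fun i hi => hs i (mem_insert_of_mem hi)
    specialize ih hst
    rcases t.eq_empty_or_nonempty with rfl | hne
    · simp [Real.exp_log ha]
    have hm : 0 < (#t : ℝ) := by exact_mod_cast hne.card_pos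
    have hm1 : 1 ≤ (#t : ℝ) := by exact_mod_cast hne.card_pos
    rw [sum_insert hat, sum_insert hat, sum_insert hat, card_insert_of_notMem hat]
    push_cast
    set L := ∑ i ∈ t, Real.log (s i) with hL
    set G := Real.exp (L / #t) with hG
    have hlogG : L = #t * Real.log G := by rw [hG, Real.log_exp]; field_simp
    have haG : s a ≤ G := by
      rw [hG, ← Real.log_le_iff_le_exp ha, le_div_iff₀ hm, mul_comm, ← nsmul_eq_mul, hL]
      exact card_nsmul_le_sum _ _ _ fun i hi => Real.log_le_log ha (hmin i hi)
    have h1 := card_mul_geomMean_le_sum_sq_sub t s hst (Real.exp_pos _) haG hlogG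
    set H := Real.exp ((Real.log (s a) + L) / (#t + 1)) with hH
    have h2 : 2 * #t * (s a * G) ≤ (#t - 1) * s a ^ 2 + (#t + 1) * H ^ 2 :=
      two_mul_mul_exp_le hm1 ha L
    nlinarith

open Finset in
/-- Kober's inequality `(∑ √xᵢ)² ≤ (n - 1) ∑ xᵢ + n (∏ xᵢ)^(1/n)`. -/
theorem sq_sum_sqrt_le_kober {n : ℕ} (hn : 0 < n) (x : Fin n → ℝ) (hx : ∀ i, 0 ≤ x i) :
    (∑ i, √(x i)) ^ 2 ≤ (n - 1) * ∑ i, x i + n * (∏ i, x i) ^ (1 / (n : ℝ)) := by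
  have hn' : (0 : ℝ) < n := by exact_mod_cast hn
  by_cases h0 : ∃ a, x a = 0
  · obtain ⟨a, ha⟩ := h0
    have hprod : ∏ i, x i = 0 := prod_eq_zero (mem_univ a) ha
    rw [hprod, Real.zero_rpow (by positivity), mul_zero, add_zero,
      ← sum_erase (univ : Finset (Fin n)) (a := a) ha,
      ← sum_erase (univ : Finset (Fin n)) (f := fun i => √(x i)) (a := a) (by simp [ha])]
    have h := sq_sum_le_card_mul_sum_sq (s := univ.erase a) (f := fun i => √(x i))
    rw [card_erase_of_mem (mem_univ a), card_univ, Fintype.card_fin, Nat.cast_sub hn] at h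
    simpa only [Real.sq_sqrt (hx _), Nat.cast_one] using h
  · push Not at h0
    have hpos : ∀ i, 0 < x i := fun i => lt_of_le_of_ne (hx i) (h0 i).symm
    have h := sq_sum_le_kober_of_pos univ (fun i => √(x i)) fun i _ => Real.sqrt_pos.2 (hpos i)
    rw [card_univ, Fintype.card_fin] at h
    simp only [Real.sq_sqrt (hx _)] at h
    convert h using 3
    rw [← Real.exp_log (prod_pos fun i _ => hpos i), ← Real.exp_mul, ← Real.exp_nat_mul,
      Real.log_prod (fun i _ => h0 i)]
    simp only [Real.log_sqrt (hx _), ← sum_div]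
    congr 1
    push_cast
    field_simp

theorem eval_esymm_eq_sum_powersetCard {n : ℕ} (k : ℕ) (x : Fin n → ℝ) :
    MvPolynomial.eval x (MvPolynomial.esymm (Fin n) ℝ k) =
      ∑ t ∈ Finset.univ.powersetCard k, ∏ i ∈ t, x i := by
  simp [MvPolynomial.esymm]

theorem eval_esymm_nonneg {n : ℕ} (k : ℕ) (x : Fin n → ℝ) (hx : ∀ i, 0 ≤ x i) :
    0 ≤ MvPolynomial.eval x (MvPolynomial.esymm (Fin n) ℝ k) := by
  rw [eval_esymm_eq_sum_powersetCard]
  exact Finset.sum_nonneg fun t _ => Finset.prod_nonneg fun i _ => hx i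

theorem sq_sum_eq_add_two_mul_esymm {n : ℕ} (x : Fin n → ℝ) :
    (∑ i, x i) ^ 2 = ∑ i, x i ^ 2 + 2 * MvPolynomial.eval x (MvPolynomial.esymm (Fin n) ℝ 2) := by
  have h := congrArg (MvPolynomial.eval x) (MvPolynomial.mul_esymm_eq_sum (Fin n) ℝ 2)
  rw [Finset.sum_filter, Finset.Nat.sum_antidiagonal_eq_sum_range_succ_mk] at h
  simp [Finset.sum_range_succ, MvPolynomial.psum, MvPolynomial.esymm_one] at h
  linarith

theorem genConcurrenceVec_nonneg (d k : ℕ) (lam : Fin d → ℝ) (h : ∀ i, 0 ≤ lam i) :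
    0 ≤ genConcurrenceVec d k lam := by
  have := eval_esymm_nonneg k lam h
  unfold genConcurrenceVec
  positivity

/-- Cauchy-Schwarz over the pairs `i < j`, combined with
`(∑ √λᵢ)² = 1 + 2 ∑_{i<j} √λᵢ √λⱼ`. -/
theorem le_genConcurrenceVec_two {d : ℕ} (hd : 2 ≤ d) (lam : Fin d → ℝ) (h : ∀ i, 0 ≤ lam i)
    (h1 : ∑ i, lam i = 1) :
    ((∑ i, √(lam i)) ^ 2 - 1) / (d - 1) ≤ genConcurrenceVec d 2 lam := by
  have hd' : (2 : ℝ) ≤ d := by exact_mod_cast hd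
  have hCS := sq_sum_le_card_mul_sum_sq (s := (Finset.univ : Finset (Fin d)).powersetCard 2)
    (f := fun t => ∏ i ∈ t, √(lam i))
  simp only [← Finset.prod_pow, Real.sq_sqrt (h _), Finset.card_powersetCard, Finset.card_univ,
    Fintype.card_fin, ← eval_esymm_eq_sum_powersetCard] at hCS
  have hsq := sq_sum_eq_add_two_mul_esymm fun i => √(lam i)
  simp only [Real.sq_sqrt (h _), h1] at hsq
  have hch : ((d.choose 2 : ℕ) : ℝ) = d * (d - 1) / 2 := Nat.cast_choose_two ℝ d
  have hchpos : (0 : ℝ) < (d.choose 2 : ℕ) := by rw [hch]; nlinarith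
  unfold genConcurrenceVec
  rw [hsq, Nat.cast_two, ← Real.sqrt_eq_rpow, ← Real.sqrt_eq_rpow]
  set c : ℝ := ((d.choose 2 : ℕ) : ℝ)
  set e := MvPolynomial.eval lam (MvPolynomial.esymm (Fin d) ℝ 2)
  have hle := Real.le_sqrt_of_sq_le hCS
  rw [Real.sqrt_mul hchpos.le] at hle
  have hcs : √c * √c = c := Real.mul_self_sqrt hchpos.le
  have hcpos : 0 < √c := Real.sqrt_pos.2 hchpos
  rw [div_le_iff₀ (by linarith)]
  have e1 : (d : ℝ) / √c * √e * (d - 1) = 2 * (√c * √e) := by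
    have : (d : ℝ) * (d - 1) = 2 * (√c * √c) := by rw [hcs, hch]; ring
    field_simp
    linear_combination √e * this
  rw [e1]
  linarith

theorem genConcurrenceVec_self_eq (d : ℕ) (lam : Fin d → ℝ) :
    genConcurrenceVec d d lam = d * (∏ i, lam i) ^ (1 / (d : ℝ)) := by
  have : (Finset.univ : Finset (Fin d)).powersetCard d = {Finset.univ} := by
    simpa using Finset.powersetCard_self (Finset.univ : Finset (Fin d))
  simp [genConcurrenceVec, eval_esymm_eq_sum_powersetCard, this]

theorem le_genConcurrenceVec_self {d : ℕ} (hd : 0 < d) (lam : Fin d → ℝ) (h : ∀ i, 0 ≤ lam i)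
    (h1 : ∑ i, lam i = 1) :
    (∑ i, √(lam i)) ^ 2 - d + 1 ≤ genConcurrenceVec d d lam := by
  have := sq_sum_sqrt_le_kober hd lam h
  rw [genConcurrenceVec_self_eq]
  rw [h1] at this
  linarith

theorem genConcurrenceVec_const {d k : ℕ} (hk : 0 < k) (hkd : k ≤ d) :
    genConcurrenceVec d k (fun _ => 1 / (d : ℝ)) = 1 := by
  have hd : (0 : ℝ) < d := by exact_mod_cast hk.trans_le hkd
  have hc : (0 : ℝ) < (d.choose k : ℕ) := by exact_mod_cast Nat.choose_pos hkd
  have hsum : ∑ t ∈ (Finset.univ : Finset (Fin d)).powersetCard k, ∏ _i ∈ t, 1 / (d : ℝ) =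
      (d.choose k : ℕ) * (1 / (d : ℝ)) ^ k := by
    rw [Finset.sum_congr rfl (g := fun _ => (1 / (d : ℝ)) ^ k) fun t ht => by
      rw [Finset.prod_const, (Finset.mem_powersetCard.1 ht).2]]
    simp
  rw [genConcurrenceVec, eval_esymm_eq_sum_powersetCard, hsum,
    Real.mul_rpow hc.le (by positivity), ← Real.rpow_natCast (1 / (d : ℝ)), ← Real.rpow_mul
    (by positivity), mul_one_div_cancel (by positivity), Real.rpow_one]
  have : (0 : ℝ) < ((d.choose k : ℕ) : ℝ) ^ (1 / (k : ℝ)) := by positivity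
  field_simp

/-- Each monomial of the `k`-th elementary symmetric polynomial contains a vanishing entry. -/
theorem genConcurrenceVec_eq_zero {d k : ℕ} (lam : Fin d → ℝ)
    (h : Fintype.card {i // lam i ≠ 0} < k) : genConcurrenceVec d k lam = 0 := by
  have hk : (k : ℝ) ≠ 0 := by exact_mod_cast (Nat.zero_le _).trans_lt h |>.ne'
  rw [genConcurrenceVec, eval_esymm_eq_sum_powersetCard, Finset.sum_eq_zero, Real.zero_rpow
    (one_div_ne_zero hk), mul_zero]
  intro t ht
  by_contra hne
  rw [← ne_eq, Finset.prod_ne_zero_iff] at hne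
  rw [Fintype.card_subtype] at h
  have := Finset.card_le_card (s := t) (t := Finset.univ.filter fun i => lam i ≠ 0)
    fun i hi => by simpa using hne i hi
  rw [(Finset.mem_powersetCard.1 ht).2] at this
  omega

/-! ### Coefficient matrices and Schmidt vectors -/

/-- The vector with a given coefficient matrix. -/
noncomputable def vecOfMatrix {d : ℕ} (A : Matrix (Fin d) (Fin d) ℂ) : BipartiteVec d :=
  WithLp.toLp 2 fun a => A a.1 a.2

theorem coeffMatrix_vecOfMatrix {d : ℕ} (A : Matrix (Fin d) (Fin d) ℂ) :
    coeffMatrix (vecOfMatrix A) = A := rfl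

theorem mem_unitVecs_iff {d : ℕ} (ψ : BipartiteVec d) :
    ψ ∈ unitVecs d ↔ ∑ i, ∑ j, ‖coeffMatrix ψ i j‖ ^ 2 = 1 := by
  have h : ‖ψ‖ ^ 2 = ∑ i, ∑ j, ‖coeffMatrix ψ i j‖ ^ 2 := by
    rw [EuclideanSpace.norm_sq_eq, Fintype.sum_prod_type]; rfl
  rw [← h, pow_eq_one_iff_of_nonneg (norm_nonneg ψ) two_ne_zero]
  rfl

theorem Matrix.mul_conjTranspose_self_apply_self {m n : Type*} [Fintype n]
    (A : Matrix m n ℂ) (i : m) :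
    (A * A.conjTranspose) i i = ((∑ j, ‖A i j‖ ^ 2 : ℝ) : ℂ) := by
  simp [Matrix.mul_apply, Complex.mul_conj']

open scoped ComplexOrder in
theorem schmidtVector_nonneg {d : ℕ} (ψ : BipartiteVec d) (i : Fin d) : 0 ≤ schmidtVector ψ i :=
  (Matrix.posSemidef_self_mul_conjTranspose (coeffMatrix ψ)).eigenvalues_nonneg i

theorem sum_schmidtVector {d : ℕ} {ψ : BipartiteVec d} (hψ : ψ ∈ unitVecs d) :
    ∑ i, schmidtVector ψ i = 1 := by
  have h := (Matrix.isHermitian_mul_conjTranspose_self (coeffMatrix ψ)).trace_eq_sum_eigenvalues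
  rw [Matrix.trace] at h
  simp only [Matrix.diag_apply, Matrix.mul_conjTranspose_self_apply_self] at h
  rw [mem_unitVecs_iff] at hψ
  rw [← hψ]
  refine Complex.ofReal_injective ?_
  push_cast at h ⊢
  exact h.symm

/-- The trace is bounded by the trace norm: with `U` diagonalizing `A Aᴴ`, the rows of `Uᴴ A` have
norms `√λᵢ`, and the columns of `U` are unit vectors. -/
theorem norm_trace_coeffMatrix_le {d : ℕ} (ψ : BipartiteVec d) :
    ‖(coeffMatrix ψ).trace‖ ≤ ∑ i, √(schmidtVector ψ i) := by
  set A := coeffMatrix ψ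
  set hA := Matrix.isHermitian_mul_conjTranspose_self A
  set U : Matrix (Fin d) (Fin d) ℂ := (hA.eigenvectorUnitary : Matrix (Fin d) (Fin d) ℂ) with hU
  set B := star U * A with hB
  have hUU : U * star U = 1 := Unitary.coe_mul_star_self _
  have hUU' : star U * U = 1 := Unitary.coe_star_mul_self _
  have hUB : U * B = A := by rw [hB, ← mul_assoc, hUU, one_mul]
  have hBB : B * B.conjTranspose = Matrix.diagonal (RCLike.ofReal ∘ hA.eigenvalues) := by
    rw [← hA.conjStarAlgAut_star_eigenvectorUnitary, Unitary.conjStarAlgAut_star_apply]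
    change star U * A * (star U * A).conjTranspose = star U * (A * A.conjTranspose) * U
    simp only [← Matrix.star_eq_conjTranspose, star_mul, star_star, mul_assoc]
  have hrow (j : Fin d) : ∑ i, ‖B j i‖ ^ 2 = schmidtVector ψ j := by
    have := congrFun (congrFun hBB j) j
    rw [Matrix.mul_conjTranspose_self_apply_self, Matrix.diagonal_apply_eq] at this
    exact Complex.ofReal_injective this
  have hcol (j : Fin d) : ∑ i, ‖U i j‖ ^ 2 = 1 := by
    have := Matrix.mul_conjTranspose_self_apply_self (star U) j
    rw [← Matrix.star_eq_conjTranspose, star_star, hUU', Matrix.one_apply_eq] at this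
    have h2 : ∑ i, ‖(star U) j i‖ ^ 2 = 1 := by exact_mod_cast this.symm
    simpa [Matrix.star_apply] using h2
  have htr : A.trace = ∑ j, ∑ i, U i j * B j i := by
    rw [Finset.sum_comm]
    conv_lhs => rw [← hUB]
    simp [Matrix.trace, Matrix.mul_apply]
  rw [htr]
  refine (norm_sum_le _ _).trans (Finset.sum_le_sum fun j _ => (norm_sum_le _ _).trans ?_)
  simp only [norm_mul]
  refine (Real.sum_mul_le_sqrt_mul_sqrt _ _ _).trans ?_
  rw [hcol, hrow, Real.sqrt_one, one_mul]

/-- The overlap `|tr A|² / d` of a vector with coefficient matrix `A` with the maximally entangled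
state. -/
noncomputable def traceOverlap {d : ℕ} (ψ : BipartiteVec d) : ℝ :=
  ‖(coeffMatrix ψ).trace‖ ^ 2 / d

theorem maxEntProj_apply {d : ℕ} (a b : Fin d × Fin d) :
    maxEntProj d a b = if a.1 = a.2 ∧ b.1 = b.2 then 1 / (d : ℂ) else 0 := by
  obtain ⟨i, j⟩ := a
  obtain ⟨k, l⟩ := b
  simp only [maxEntProj, Matrix.smul_apply, Matrix.sum_apply, Matrix.single_apply, Prod.mk.injEq]
  by_cases h1 : i = j
  · by_cases h2 : k = l
    · subst h1 h2
      rw [Finset.sum_eq_single i (by intro x _ hx; simp [hx]) (by simp),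
        Finset.sum_eq_single k (by intro x _ hx; simp [hx]) (by simp)]
      simp
    · rw [if_neg (by tauto), Finset.sum_eq_zero, smul_zero]
      exact fun x _ => Finset.sum_eq_zero fun y _ => if_neg fun h => h2 (h.2.1.symm.trans h.2.2)
  · rw [if_neg (by tauto), Finset.sum_eq_zero, smul_zero]
    exact fun x _ => Finset.sum_eq_zero fun y _ => if_neg fun h => h1 (h.1.1.symm.trans h.1.2)

theorem trace_maxEntProj_mul {d : ℕ} (ρ : BipartiteOp d) :
    (maxEntProj d * ρ).trace = 1 / d * ∑ i, ∑ k, ρ (k, k) (i, i) := by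
  simp [Matrix.trace, Matrix.mul_apply, maxEntProj_apply, Fintype.sum_prod_type, ite_and,
    Finset.mul_sum]

/-- The expectation value `re tr (Φ_d ρ)` of the projection onto the maximally entangled state. -/
noncomputable def maxEntFidelity (d : ℕ) : BipartiteOp d →ₗ[ℝ] ℝ :=
  Complex.reLm ∘ₗ (Matrix.traceLinearMap (Fin d × Fin d) ℝ ℂ) ∘ₗ LinearMap.mulLeft ℝ (maxEntProj d)

theorem maxEntFidelity_apply {d : ℕ} (ρ : BipartiteOp d) :
    maxEntFidelity d ρ = (1 / d * ∑ i, ∑ k, ρ (k, k) (i, i)).re := by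
  rw [← trace_maxEntProj_mul]; rfl

theorem maxEntFidelity_ketBra {d : ℕ} (ψ : BipartiteVec d) :
    maxEntFidelity d (ketBra ψ) = traceOverlap ψ := by
  have h : (1 / d * ∑ i, ∑ k, ketBra ψ (k, k) (i, i) : ℂ) = (traceOverlap ψ : ℂ) := by
    have : (∑ i, ∑ k, ketBra ψ (k, k) (i, i) : ℂ) =
        (coeffMatrix ψ).trace * star (coeffMatrix ψ).trace := by
      rw [Finset.sum_comm, Matrix.trace, star_sum, Finset.sum_mul_sum]
      rfl
    rw [this, traceOverlap, Complex.star_def, Complex.mul_conj']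
    push_cast
    ring
  rw [maxEntFidelity_apply, h, Complex.ofReal_re]

theorem overlapMaxEnt_eq {d : ℕ} (ψ : BipartiteVec d) : overlapMaxEnt ψ = (traceOverlap ψ : ℂ) := by
  have h : overlapMaxEnt ψ = 1 / d * (star (coeffMatrix ψ).trace * (coeffMatrix ψ).trace) := by
    simp only [overlapMaxEnt, dotProduct, Matrix.mulVec, maxEntProj_apply, Fintype.sum_prod_type,
      ite_and, Matrix.trace, Matrix.diag_apply, coeffMatrix, Matrix.of_apply, star_sum,
      Finset.mul_sum]
    simp [Finset.mul_sum, Finset.sum_mul]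
    rw [Finset.sum_comm]
    refine Finset.sum_congr rfl fun i _ => Finset.sum_congr rfl fun j _ => ?_
    ring
  rw [h, traceOverlap, Complex.star_def, Complex.conj_mul']
  push_cast
  ring

theorem traceOverlap_mem_Icc {d : ℕ} (hd : 0 < d) {ψ : BipartiteVec d} (hψ : ψ ∈ unitVecs d) :
    traceOverlap ψ ∈ Set.Icc (0 : ℝ) 1 := by
  have hd' : (0 : ℝ) < d := by exact_mod_cast hd
  refine ⟨by unfold traceOverlap; positivity, ?_⟩
  rw [traceOverlap, div_le_one hd']
  have hCS := sq_sum_le_card_mul_sum_sq (s := (Finset.univ : Finset (Fin d)))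
    (f := fun i => √(schmidtVector ψ i))
  simp only [Real.sq_sqrt (schmidtVector_nonneg ψ _), sum_schmidtVector hψ, Finset.card_univ,
    Fintype.card_fin, mul_one] at hCS
  exact (pow_le_pow_left₀ (norm_nonneg _) (norm_trace_coeffMatrix_le ψ) 2).trans hCS

theorem genConcurrence_nonneg {d : ℕ} (k : ℕ) (ψ : BipartiteVec d) : 0 ≤ genConcurrence d k ψ :=
  genConcurrenceVec_nonneg d k _ (schmidtVector_nonneg ψ)

theorem mul_traceOverlap_le {d : ℕ} (hd : 0 < d) (ψ : BipartiteVec d) :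
    d * traceOverlap ψ ≤ (∑ i, √(schmidtVector ψ i)) ^ 2 := by
  have hd' : (0 : ℝ) < d := by exact_mod_cast hd
  rw [traceOverlap, mul_div_cancel₀ _ hd'.ne']
  exact pow_le_pow_left₀ (norm_nonneg _) (norm_trace_coeffMatrix_le ψ) 2

theorem le_genConcurrence_two {d : ℕ} (hd : 2 ≤ d) {ψ : BipartiteVec d} (hψ : ψ ∈ unitVecs d) :
    (d * traceOverlap ψ - 1) / (d - 1) ≤ genConcurrence d 2 ψ := by
  have hd' : (2 : ℝ) ≤ d := by exact_mod_cast hd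
  refine le_trans ?_ (le_genConcurrenceVec_two hd _ (schmidtVector_nonneg ψ) (sum_schmidtVector hψ))
  have := mul_traceOverlap_le (by omega) ψ
  gcongr
  linarith

theorem le_genConcurrence_self {d : ℕ} (hd : 0 < d) {ψ : BipartiteVec d} (hψ : ψ ∈ unitVecs d) :
    d * traceOverlap ψ - d + 1 ≤ genConcurrence d d ψ := by
  refine le_trans ?_ (le_genConcurrenceVec_self hd _ (schmidtVector_nonneg ψ) (sum_schmidtVector hψ))
  linarith [mul_traceOverlap_le hd ψ]

open scoped ComplexOrder in
/-- The number of nonzero Schmidt coefficients is the rank of the coefficient matrix. -/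
theorem genConcurrence_eq_zero_of_rank_lt {d k : ℕ} {ψ : BipartiteVec d}
    (h : (coeffMatrix ψ).rank < k) : genConcurrence d k ψ = 0 := by
  refine genConcurrenceVec_eq_zero _ ?_
  rw [← Matrix.rank_self_mul_conjTranspose,
    (Matrix.isHermitian_mul_conjTranspose_self (coeffMatrix ψ)).rank_eq_card_non_zero_eigs] at h
  exact h

/-- The maximally entangled unit vector `∑ i, |i i⟩ / √d`. -/
noncomputable def maxEntVec (d : ℕ) : BipartiteVec d :=
  vecOfMatrix (Matrix.diagonal fun _ => ((1 / √d : ℝ) : ℂ))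

theorem one_div_sqrt_mul_self (d : ℕ) : (1 / √(d : ℝ)) * (1 / √(d : ℝ)) = 1 / d := by
  rw [div_mul_div_comm, Real.mul_self_sqrt (Nat.cast_nonneg d), one_mul]

theorem maxEntVec_mem_unitVecs {d : ℕ} (hd : 0 < d) : maxEntVec d ∈ unitVecs d := by
  have hd' : (0 : ℝ) < d := by exact_mod_cast hd
  rw [mem_unitVecs_iff, maxEntVec, coeffMatrix_vecOfMatrix]
  have (i j : Fin d) : ‖Matrix.diagonal (fun _ : Fin d => ((1 / √d : ℝ) : ℂ)) i j‖ ^ 2 =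
      if i = j then 1 / (d : ℝ) else 0 := by
    rw [Matrix.diagonal_apply]
    split_ifs
    · rw [Complex.norm_real, Real.norm_eq_abs, sq_abs, sq, one_div_sqrt_mul_self]
    · simp
  simp only [this, Finset.sum_ite_eq, Finset.mem_univ, if_true, Finset.sum_const,
    Finset.card_univ, Fintype.card_fin, nsmul_eq_mul]
  exact mul_one_div_cancel hd'.ne'

theorem ketBra_maxEntVec {d : ℕ} : ketBra (maxEntVec d) = maxEntProj d := by
  ext a b
  rw [maxEntProj_apply]
  simp only [ketBra, maxEntVec, vecOfMatrix, Matrix.of_apply, Matrix.diagonal_apply]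
  by_cases h1 : a.1 = a.2 <;> by_cases h2 : b.1 = b.2 <;> simp only [h1, h2, if_true, if_false,
    and_self, and_true, and_false, star_zero, mul_zero, zero_mul]
  rw [Complex.star_def, Complex.conj_ofReal, ← Complex.ofReal_mul, one_div_sqrt_mul_self]
  push_cast
  rfl

theorem genConcurrence_maxEntVec {d k : ℕ} (hk : 0 < k) (hkd : k ≤ d) :
    genConcurrence d k (maxEntVec d) = 1 := by
  rw [genConcurrence, ← genConcurrenceVec_const hk hkd]
  congr 1
  funext i
  set A := coeffMatrix (maxEntVec d) with hA
  set hH := Matrix.isHermitian_mul_conjTranspose_self A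
  have hAA : A * A.conjTranspose = Matrix.diagonal fun _ => ((1 / (d : ℝ) : ℝ) : ℂ) := by
    rw [hA, maxEntVec, coeffMatrix_vecOfMatrix, Matrix.diagonal_conjTranspose,
      Matrix.diagonal_mul_diagonal]
    congr 1
    funext x
    rw [Pi.star_apply, Complex.star_def, Complex.conj_ofReal, ← Complex.ofReal_mul,
      one_div_sqrt_mul_self]
  have hev := hH.mulVec_eigenvectorBasis i
  have hne : (hH.eigenvectorBasis i) ≠ 0 := by
    intro h
    simpa [h] using hH.eigenvectorBasis.orthonormal.1 i
  obtain ⟨j, hj⟩ : ∃ j, hH.eigenvectorBasis i j ≠ 0 := by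
    by_contra! h
    exact hne (PiLp.ext h)
  have := congrFun hev j
  rw [congrArg (fun M => M.mulVec (hH.eigenvectorBasis i).ofLp) hAA] at this
  rw [Matrix.mulVec_diagonal, Pi.smul_apply, Complex.real_smul] at this
  exact Complex.ofReal_injective (mul_right_cancel₀ hj this).symm

/-! ### Convex roofs -/

section ConvexRoof

variable {X Y V W : Type*} [AddCommGroup V] [Module ℝ V] [AddCommGroup W] [Module ℝ W]

/-- A convex roof lies above every affine function that the original function lies above. -/
theorem le_convexRoof (S : Set X) (pt : X → V) (f : X → ℝ) (l : V →ₗ[ℝ] ℝ) (m c : ℝ)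
    (h : ∀ y ∈ S, m * l (pt y) + c ≤ f y) (x : V) :
    ((m * l x + c : ℝ) : EReal) ≤ convexRoof S pt f x := by
  refine le_sInf ?_
  rintro _ ⟨n, p, y, hp, hp1, hy, rfl, rfl⟩
  rw [EReal.coe_le_coe_iff]
  calc m * l (∑ i, p i • pt (y i)) + c = ∑ i, p i * (m * l (pt (y i)) + c) := by
        simp only [map_sum, map_smul, smul_eq_mul, mul_add, Finset.sum_add_distrib,
          ← Finset.sum_mul, hp1, one_mul, Finset.mul_sum, mul_left_comm]
    _ ≤ _ := Finset.sum_le_sum fun i _ => mul_le_mul_of_nonneg_left (h _ (hy i)) (hp i)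

/-- Points of the convex hull of the graph bound the convex roof from above. -/
theorem convexRoof_le_of_mem_convexHull {S : Set X} {pt : X → V} {f : X → ℝ} {x : V} {c : ℝ}
    (h : (x, c) ∈ convexHull ℝ ((fun y => (pt y, f y)) '' S)) :
    convexRoof S pt f x ≤ (c : EReal) := by
  obtain ⟨ι, _, w, z, hw, hw1, hz, hx⟩ := mem_convexHull_iff_exists_fintype.1 h
  choose y hyS hyz using hz
  refine sInf_le ⟨Fintype.card ι, fun i => w ((Fintype.equivFin ι).symm i),
    fun i => y ((Fintype.equivFin ι).symm i), fun i => hw _, ?_, fun i => hyS _, ?_, ?_⟩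
  · rw [← hw1]
    exact Equiv.sum_comp (Fintype.equivFin ι).symm w
  · rw [Equiv.sum_comp (Fintype.equivFin ι).symm fun i => w i • pt (y i)]
    simpa [← hyz, Prod.fst_sum] using congrArg Prod.fst hx
  · rw [Equiv.sum_comp (Fintype.equivFin ι).symm fun i => w i * f (y i)]
    have := congrArg Prod.snd hx
    simp only [← hyz, Prod.snd_sum, Prod.smul_mk, smul_eq_mul] at this
    rw [this]

/-- A linear image of a decomposition is a decomposition of the image. -/
theorem convexRoof_map_le {S : Set X} {pt : X → V} {f : X → ℝ} {T : Set Y} {pt' : Y → W}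
    {f' : Y → ℝ} (L : V →ₗ[ℝ] W) (q : X → Y) (hq : ∀ y ∈ S, q y ∈ T)
    (hpt : ∀ y ∈ S, pt' (q y) = L (pt y)) (hf : ∀ y ∈ S, f' (q y) ≤ f y) (x : V) :
    convexRoof T pt' f' (L x) ≤ convexRoof S pt f x := by
  refine le_sInf ?_
  rintro _ ⟨n, p, y, hp, hp1, hy, rfl, rfl⟩
  have h : convexRoof T pt' f' (L (∑ i, p i • pt (y i))) ≤
      ((∑ i, p i * f' (q (y i)) : ℝ) : EReal) := by
    refine sInf_le ⟨n, p, fun i => q (y i), hp, hp1, fun i => hq _ (hy i), ?_, rfl⟩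
    simp only [map_sum, map_smul]
    exact Finset.sum_congr rfl fun i _ => by rw [hpt _ (hy i)]
  refine h.trans ?_
  rw [EReal.coe_le_coe_iff]
  exact Finset.sum_le_sum fun i _ => mul_le_mul_of_nonneg_left (hf _ (hy i)) (hp i)

end ConvexRoof

/-! ### The minimum over pure states of given overlap -/

/-- Every value in `[0, 1]` is the overlap of `√b ∑ i, |i i⟩ / √d + √(1 - b) |0 1⟩`. -/
theorem exists_unitVec_traceOverlap_eq {d : ℕ} (hd : 2 ≤ d) {b : ℝ} (hb : b ∈ Set.Icc (0 : ℝ) 1) :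
    ∃ ψ ∈ unitVecs d, traceOverlap ψ = b := by
  obtain ⟨hb0, hb1⟩ := hb
  have hd' : (0 : ℝ) < d := by exact_mod_cast (by omega : 0 < d)
  let i₀ : Fin d := ⟨0, by omega⟩
  let i₁ : Fin d := ⟨1, by omega⟩
  have h01 : i₀ ≠ i₁ := by simp [i₀, i₁]
  let A : Matrix (Fin d) (Fin d) ℂ := Matrix.of fun i j =>
    if i = j then ((√(b / d) : ℝ) : ℂ) else if i = i₀ ∧ j = i₁ then ((√(1 - b) : ℝ) : ℂ) else 0
  have hA (i j : Fin d) : ‖A i j‖ ^ 2 =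
      (if i = j then b / d else 0) + if i = i₀ then (if j = i₁ then 1 - b else 0) else 0 := by
    simp only [A, Matrix.of_apply]
    by_cases h : i = j
    · have : ¬(i = i₀ ∧ j = i₁) := fun h' => h01 (h'.1.symm.trans (h.trans h'.2))
      rw [← ite_and, if_pos h, if_pos h, if_neg this, Complex.norm_real, Real.norm_eq_abs, sq_abs,
        Real.sq_sqrt (by positivity), add_zero]
    · rw [← ite_and, if_neg h, if_neg h]
      split_ifs
      · rw [Complex.norm_real, Real.norm_eq_abs, sq_abs, Real.sq_sqrt (by linarith), zero_add]
      · simp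
  refine ⟨vecOfMatrix A, ?_, ?_⟩
  · rw [mem_unitVecs_iff, coeffMatrix_vecOfMatrix]
    simp only [hA, Finset.sum_add_distrib, Finset.sum_ite_eq, Finset.mem_univ,
      if_true, Finset.sum_const, Finset.card_univ, Fintype.card_fin, nsmul_eq_mul]
    rw [Finset.sum_eq_single i₀ (by intro x _ hx; simp [hx]) (by simp)]
    simp
    field_simp
    ring
  · have htr : A.trace = ((d * √(b / d) : ℝ) : ℂ) := by
      simp [A, Matrix.trace]
    rw [traceOverlap, coeffMatrix_vecOfMatrix, htr, Complex.norm_real, Real.norm_eq_abs, sq_abs,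
      mul_pow, Real.sq_sqrt (by positivity)]
    field_simp

theorem isoMin_traceOverlap_le {d : ℕ} {E : BipartiteVec d → ℝ} (hE : ∀ ψ, 0 ≤ E ψ)
    {ψ : BipartiteVec d} (hψ : ψ ∈ unitVecs d) : isoMin E (traceOverlap ψ) ≤ E ψ :=
  csInf_le ⟨0, by rintro _ ⟨φ, _, _, rfl⟩; exact hE φ⟩ ⟨ψ, hψ, overlapMaxEnt_eq ψ, rfl⟩

theorem le_isoMin {d : ℕ} (hd : 2 ≤ d) {E : BipartiteVec d → ℝ} {m c : ℝ}
    (h : ∀ ψ ∈ unitVecs d, m * traceOverlap ψ + c ≤ E ψ) {b : ℝ} (hb : b ∈ Set.Icc (0 : ℝ) 1) :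
    m * b + c ≤ isoMin E b := by
  obtain ⟨ψ, hψ, hψb⟩ := exists_unitVec_traceOverlap_eq hd hb
  refine le_csInf ⟨E ψ, ψ, hψ, by rw [overlapMaxEnt_eq, hψb], rfl⟩ ?_
  rintro _ ⟨φ, hφ, hφb, rfl⟩
  rw [overlapMaxEnt_eq, Complex.ofReal_inj] at hφb
  rw [← hφb]
  exact h φ hφ

theorem le_isoMinRoof {d : ℕ} (hd : 2 ≤ d) {E : BipartiteVec d → ℝ} {m c : ℝ}
    (h : ∀ ψ ∈ unitVecs d, m * traceOverlap ψ + c ≤ E ψ) (b : ℝ) :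
    ((m * b + c : ℝ) : EReal) ≤ isoMinRoof E b :=
  le_convexRoof _ id (isoMin E) LinearMap.id m c (fun _ hy => le_isoMin hd h hy) b

theorem isotropicState_apply {d : ℕ} (b : ℝ) (x y : Fin d × Fin d) :
    isotropicState d b x y =
      (if x.1 = x.2 ∧ y.1 = y.2 then ((b : ℂ) - (1 - b) / ((d : ℂ) ^ 2 - 1)) / d else 0) +
        if x = y then (1 - (b : ℂ)) / ((d : ℂ) ^ 2 - 1) else 0 := by
  simp only [isotropicState, Matrix.add_apply, Matrix.smul_apply, Matrix.sub_apply,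
    maxEntProj_apply, Matrix.one_apply, smul_eq_mul]
  push_cast
  split_ifs <;> ring

theorem maxEntFidelity_isotropicState {d : ℕ} (hd : 2 ≤ d) (b : ℝ) :
    maxEntFidelity d (isotropicState d b) = b := by
  have hd' : (2 : ℝ) ≤ d := by exact_mod_cast hd
  have h0 : (d : ℂ) ≠ 0 := by exact_mod_cast (by omega : d ≠ 0)
  have h1 : (d : ℂ) ^ 2 - 1 ≠ 0 := by
    have : (d : ℝ) ^ 2 - 1 ≠ 0 := by nlinarith
    exact_mod_cast this
  rw [maxEntFidelity_apply]
  simp only [isotropicState_apply, and_self, if_true, Prod.mk.injEq, Finset.sum_add_distrib,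
    Finset.sum_ite_eq', Finset.mem_univ, Finset.sum_const, Finset.card_univ, Fintype.card_fin,
    nsmul_eq_mul]
  rw [← Complex.ofReal_re b]
  congr 1
  rw [Complex.ofReal_re]
  field_simp
  ring

theorem isoMinRoof_le_stateRoof {d : ℕ} (hd : 2 ≤ d) {E : BipartiteVec d → ℝ} (hE : ∀ ψ, 0 ≤ E ψ)
    (b : ℝ) : isoMinRoof E b ≤ stateRoof E (isotropicState d b) := by
  have h := convexRoof_map_le (S := unitVecs d) (pt := ketBra) (f := E) (T := Set.Icc (0 : ℝ) 1)
    (pt' := id) (f' := isoMin E) (maxEntFidelity d) traceOverlap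
    (fun ψ hψ => traceOverlap_mem_Icc (by omega) hψ) (fun ψ _ => (maxEntFidelity_ketBra ψ).symm)
    (fun ψ hψ => isoMin_traceOverlap_le hE hψ) (isotropicState d b)
  rwa [maxEntFidelity_isotropicState hd] at h

/-- Points `(ρ, e)` of `roofHull E` are the finite mixtures `(∑ pᵢ |ψᵢ⟩⟨ψᵢ|, ∑ pᵢ E ψᵢ)`. -/
def roofHull {d : ℕ} (E : BipartiteVec d → ℝ) : Set (BipartiteOp d × ℝ) :=
  convexHull ℝ ((fun ψ => (ketBra ψ, E ψ)) '' unitVecs d)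

/-- An affine lower bound on pure states that is attained by some mixture giving the isotropic
state determines both convex roofs. -/
theorem roofs_eq_of_mem_roofHull {d : ℕ} (hd : 2 ≤ d) {E : BipartiteVec d → ℝ}
    (hE : ∀ ψ, 0 ≤ E ψ) {m c : ℝ} (h : ∀ ψ ∈ unitVecs d, m * traceOverlap ψ + c ≤ E ψ) {b : ℝ}
    (hb : (isotropicState d b, m * b + c) ∈ roofHull E) :
    stateRoof E (isotropicState d b) = ((m * b + c : ℝ) : EReal) ∧
      isoMinRoof E b = ((m * b + c : ℝ) : EReal) := by
  have h1 := le_isoMinRoof hd h b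
  have h2 := isoMinRoof_le_stateRoof hd hE b
  have h3 : stateRoof E (isotropicState d b) ≤ ((m * b + c : ℝ) : EReal) :=
    convexRoof_le_of_mem_convexHull hb
  exact ⟨le_antisymm h3 (h1.trans h2), le_antisymm (h2.trans h3) h1⟩

/-- `roofHull` contains the segment between two isotropic states on the graph of an affine
function. -/
theorem isotropicState_mem_roofHull_of_mem_Icc {d : ℕ} {E : BipartiteVec d → ℝ} {m c b₀ b₁ b : ℝ}
    (h₀ : (isotropicState d b₀, m * b₀ + c) ∈ roofHull E)
    (h₁ : (isotropicState d b₁, m * b₁ + c) ∈ roofHull E) (hb : b ∈ Set.Icc b₀ b₁) :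
    (isotropicState d b, m * b + c) ∈ roofHull E := by
  rw [← segment_eq_Icc (hb.1.trans hb.2)] at hb
  obtain ⟨s, t, hs, ht, hst, rfl⟩ := hb
  obtain rfl : s = 1 - t := by linarith
  have h : (1 - t) • (isotropicState d b₀, m * b₀ + c) + t • (isotropicState d b₁, m * b₁ + c) ∈
      roofHull E := convex_convexHull ℝ _ h₀ h₁ hs ht hst
  convert h using 1
  refine Prod.ext ?_ ?_
  · ext x y
    simp only [isotropicState_apply, Prod.fst_add, Prod.smul_fst, Matrix.add_apply,
      Matrix.smul_apply, Complex.real_smul, smul_eq_mul, Complex.ofReal_add, Complex.ofReal_mul,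
      Complex.ofReal_sub, Complex.ofReal_one]
    split_ifs <;> ring
  · simp only [smul_eq_mul, Prod.snd_add, Prod.smul_snd]
    ring

/-! ### Twirling over monomial unitaries -/

/-- A state that commutes with all `U ⊗ Ū`, `U` a diagonal unitary or a permutation matrix, has only
the entries `⟨ii|ρ|ii⟩`, `⟨ij|ρ|ij⟩` and `⟨ii|ρ|kk⟩`, each independent of the indices. The three
sums fix them; the diagonal sum `hD` is the one that isotropic states have. -/
theorem eq_isotropicState_of_invariant {d : ℕ} (hd : 2 ≤ d) {b : ℝ} (M : BipartiteOp d)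
    (h0 : ∀ i j k l, ¬(i = j ∧ k = l) → ¬(i = k ∧ j = l) → M (i, j) (k, l) = 0)
    (hσ : ∀ (σ : Equiv.Perm (Fin d)) (i j k l),
      M (σ i, σ j) (σ k, σ l) = M (i, j) (k, l))
    (htr : ∑ i, ∑ j, M (i, j) (i, j) = 1)
    (hΦ : ∑ i, ∑ k, M (i, i) (k, k) = d * b)
    (hD : ∑ i, M (i, i) (i, i) = (1 + d * b) / (d + 1)) :
    M = isotropicState d b := by
  let i₀ : Fin d := ⟨0, by omega⟩
  let i₁ : Fin d := ⟨1, by omega⟩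
  have h01 : i₀ ≠ i₁ := by simp [i₀, i₁]
  have htrans : ∀ i j : Fin d, i ≠ j → ∃ σ : Equiv.Perm (Fin d), σ i₀ = i ∧ σ i₁ = j :=
    fun i j hij => MulAction.is_two_pretransitive_iff.1
      (Equiv.Perm.isMultiplyPretransitive (Fin d) 2) h01 hij
  have hα : ∀ i, M (i, i) (i, i) = M (i₀, i₀) (i₀, i₀) := fun i => by
    have := hσ (Equiv.swap i₀ i) i₀ i₀ i₀ i₀
    rwa [Equiv.swap_apply_left] at this
  have hβ : ∀ i j, i ≠ j → M (i, j) (i, j) = M (i₀, i₁) (i₀, i₁) := fun i j hij => by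
    obtain ⟨σ, rfl, rfl⟩ := htrans i j hij
    exact hσ σ _ _ _ _
  have hγ : ∀ i k, i ≠ k → M (i, i) (k, k) = M (i₀, i₀) (i₁, i₁) := fun i j hij => by
    obtain ⟨σ, rfl, rfl⟩ := htrans i j hij
    exact hσ σ _ _ _ _
  set α := M (i₀, i₀) (i₀, i₀)
  set β := M (i₀, i₁) (i₀, i₁)
  set γ := M (i₀, i₀) (i₁, i₁)
  have hsum : ∀ x y : ℂ, ∑ i : Fin d, ∑ j : Fin d, (if i = j then x else y) =
      d * x + d * (d - 1) * y := by
    intro x y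
    have : ∀ i j : Fin d, (if i = j then x else y) = (if i = j then x - y else 0) + y := by
      intro i j; split_ifs <;> ring
    simp only [this, Finset.sum_add_distrib, Finset.sum_ite_eq, Finset.mem_univ, if_true,
      Finset.sum_const, Finset.card_univ, Fintype.card_fin, nsmul_eq_mul]
    ring
  have eβ : ∀ i j, M (i, j) (i, j) = if i = j then α else β := fun i j => by
    split_ifs with h
    · rw [h, hα]
    · exact hβ i j h
  have eγ : ∀ i k, M (i, i) (k, k) = if i = k then α else γ := fun i k => by
    split_ifs with h
    · rw [h, hα]
    · exact hγ i k h
  simp only [eβ, hsum] at htr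
  simp only [eγ, hsum] at hΦ
  simp only [hα, Finset.sum_const, Finset.card_univ, Fintype.card_fin, nsmul_eq_mul] at hD
  have c0 : (d : ℂ) ≠ 0 := by exact_mod_cast (by omega : d ≠ 0)
  have c1 : (d : ℂ) + 1 ≠ 0 := by exact_mod_cast (by omega : d + 1 ≠ 0)
  have c2 : (d : ℂ) - 1 ≠ 0 := by
    rw [sub_ne_zero]; exact_mod_cast (by omega : d ≠ 1)
  have c3 : (d : ℂ) ^ 2 - 1 ≠ 0 := by
    have : (d : ℂ) ^ 2 - 1 = (d + 1) * (d - 1) := by ring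
    rw [this]; exact mul_ne_zero c1 c2
  have vα : α = (1 + d * b) / (d * (d + 1)) := by
    rw [eq_div_iff (mul_ne_zero c0 c1)]
    rw [eq_div_iff c1] at hD
    linear_combination hD
  have vβ : β = (1 - b) / ((d : ℂ) ^ 2 - 1) := by
    rw [hD] at htr
    rw [eq_div_iff c3]
    refine mul_left_cancel₀ c0 ?_
    field_simp at htr
    linear_combination htr
  have vγ : γ = ((b : ℂ) - (1 - b) / ((d : ℂ) ^ 2 - 1)) / d := by
    rw [hD] at hΦ
    rw [eq_div_iff c0]
    refine mul_left_cancel₀ c3 ?_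
    field_simp at hΦ ⊢
    linear_combination hΦ
  have hsplit : α = β + γ := by
    rw [vα, vβ, vγ]
    field_simp
    ring
  ext ⟨i, j⟩ ⟨k, l⟩
  rw [isotropicState_apply, ← vγ, ← vβ]
  simp only [Prod.mk.injEq]
  by_cases h1 : i = j ∧ k = l
  · obtain ⟨rfl, rfl⟩ := h1
    rw [eγ, hsplit]
    by_cases h : i = k <;> simp [h, add_comm]
  · rw [if_neg h1, zero_add]
    by_cases h2 : i = k ∧ j = l
    · obtain ⟨rfl, rfl⟩ := h2
      have : i ≠ j := fun h => h1 ⟨h, h⟩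
      rw [eβ]
      simp [this]
    · rw [h0 i j k l h1 h2, if_neg h2]

/-- The parameters of the monomial unitaries used for twirling: phases that are fourth roots of
unity, and a permutation. -/
abbrev TwirlIndex (d : ℕ) : Type := (Fin d → rootsOfUnity 4 ℂ) × Equiv.Perm (Fin d)

noncomputable instance (d : ℕ) : Fintype (TwirlIndex d) := Fintype.ofFinite _

/-- The phase, as a complex number, of the `i`-th row. -/
def TwirlIndex.phase {d : ℕ} (g : TwirlIndex d) (i : Fin d) : ℂ := ((g.1 i : ℂˣ) : ℂ)

theorem TwirlIndex.norm_phase {d : ℕ} (g : TwirlIndex d) (i : Fin d) : ‖g.phase i‖ = 1 :=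
  Complex.norm_eq_one_of_mem_rootsOfUnity (g.1 i).2

/-- The coefficient matrix `U A Uᴴ` of `(U ⊗ Ū) ψ`, where `U` is the monomial unitary of `g`. -/
def twirlMatrix {d : ℕ} (A : Matrix (Fin d) (Fin d) ℂ) (g : TwirlIndex d) :
    Matrix (Fin d) (Fin d) ℂ :=
  Matrix.of fun i j => g.phase i * star (g.phase j) * A (g.2 i) (g.2 j)

theorem norm_twirlMatrix_apply {d : ℕ} (A : Matrix (Fin d) (Fin d) ℂ) (g : TwirlIndex d)
    (i j : Fin d) : ‖twirlMatrix A g i j‖ = ‖A (g.2 i) (g.2 j)‖ := by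
  simp [twirlMatrix, g.norm_phase]

theorem twirlMatrix_apply_self {d : ℕ} (A : Matrix (Fin d) (Fin d) ℂ) (g : TwirlIndex d)
    (i : Fin d) : twirlMatrix A g i i = A (g.2 i) (g.2 i) := by
  simp [twirlMatrix, Complex.mul_conj', g.norm_phase]

theorem rank_twirlMatrix_le {d : ℕ} (A : Matrix (Fin d) (Fin d) ℂ) (g : TwirlIndex d) :
    (twirlMatrix A g).rank ≤ A.rank := by
  have : twirlMatrix A g = Matrix.diagonal g.phase * A.submatrix g.2 g.2 *
      Matrix.diagonal (star g.phase) := by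
    ext i j
    rw [Matrix.mul_diagonal, Matrix.diagonal_mul]
    simp only [twirlMatrix, Matrix.of_apply, Matrix.submatrix_apply, Pi.star_apply]
    ring
  rw [this, ← Matrix.rank_submatrix A g.2 g.2]
  exact (Matrix.rank_mul_le_left _ _).trans (Matrix.rank_mul_le_right _ _)

theorem vecOfMatrix_twirlMatrix_mem_unitVecs {d : ℕ} {A : Matrix (Fin d) (Fin d) ℂ}
    (hA : ∑ i, ∑ j, ‖A i j‖ ^ 2 = 1) (g : TwirlIndex d) :
    vecOfMatrix (twirlMatrix A g) ∈ unitVecs d := by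
  rw [mem_unitVecs_iff, coeffMatrix_vecOfMatrix, ← hA,
    ← Equiv.sum_comp g.2 fun i => ∑ j, ‖A i j‖ ^ 2]
  simp only [norm_twirlMatrix_apply]
  exact Finset.sum_congr rfl fun i _ => Equiv.sum_comp g.2 fun j => ‖A (g.2 i) j‖ ^ 2

/-- The unnormalized twirl of the pure state with coefficient matrix `A`. -/
noncomputable def twirlSum {d : ℕ} (A : Matrix (Fin d) (Fin d) ℂ) : BipartiteOp d :=
  ∑ g : TwirlIndex d, ketBra (vecOfMatrix (twirlMatrix A g))

theorem twirlSum_apply {d : ℕ} (A : Matrix (Fin d) (Fin d) ℂ) (i j k l : Fin d) :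
    twirlSum A (i, j) (k, l) =
      ∑ g : TwirlIndex d, twirlMatrix A g i j * star (twirlMatrix A g k l) := by
  rw [twirlSum, Matrix.sum_apply]
  rfl

theorem twirlSum_perm {d : ℕ} (A : Matrix (Fin d) (Fin d) ℂ) (σ : Equiv.Perm (Fin d))
    (i j k l : Fin d) : twirlSum A (σ i, σ j) (σ k, σ l) = twirlSum A (i, j) (k, l) := by
  rw [twirlSum_apply, twirlSum_apply]
  refine Fintype.sum_equiv ((Equiv.arrowCongr σ.symm (Equiv.refl _)).prodCongr
    (Equiv.mulRight σ)) _ _ fun g => ?_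
  simp [twirlMatrix, TwirlIndex.phase]

theorem twirlSum_phase {d : ℕ} (A : Matrix (Fin d) (Fin d) ℂ) (w : Fin d → rootsOfUnity 4 ℂ)
    (i j k l : Fin d) :
    twirlSum A (i, j) (k, l) = ((w i : ℂˣ) : ℂ) * star ((w j : ℂˣ) : ℂ) *
      (star ((w k : ℂˣ) : ℂ) * ((w l : ℂˣ) : ℂ)) * twirlSum A (i, j) (k, l) := by
  conv_lhs => rw [twirlSum_apply]
  rw [twirlSum_apply, Finset.mul_sum]
  symm
  refine Fintype.sum_equiv ((Equiv.mulLeft w).prodCongr (Equiv.refl _)) _ _ fun g => ?_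
  simp only [twirlMatrix, TwirlIndex.phase, Matrix.of_apply, Equiv.prodCongr_apply, Prod.map,
    Equiv.coe_mulLeft, Equiv.refl_apply, Pi.mul_apply, Subgroup.coe_mul, Units.val_mul,
    star_mul', star_star]
  ring

/-- The imaginary unit as a fourth root of unity. -/
def rootI : rootsOfUnity 4 ℂ := rootsOfUnity.mkOfPowEq Complex.I Complex.I_pow_four

theorem coe_rootI : ((rootI : ℂˣ) : ℂ) = Complex.I := rootsOfUnity.coe_mkOfPowEq _

theorem twirlSum_eq_zero {d : ℕ} (A : Matrix (Fin d) (Fin d) ℂ) (i j k l : Fin d)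
    (h1 : ¬(i = j ∧ k = l)) (h2 : ¬(i = k ∧ j = l)) : twirlSum A (i, j) (k, l) = 0 := by
  -- It suffices to have a phase that multiplies the entry by a number other than `1`.
  by_contra hne
  have key : ∀ a : Fin d, ((if i = a then Complex.I else 1) * star (if j = a then Complex.I else 1) *
      (star (if k = a then Complex.I else 1) * (if l = a then Complex.I else 1)) : ℂ) = 1 := by
    intro a
    have h := twirlSum_phase A (fun x => if x = a then rootI else 1) i j k l
    have e : ∀ x : Fin d, (((if x = a then rootI else 1 : rootsOfUnity 4 ℂ) : ℂˣ) : ℂ) =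
        if x = a then Complex.I else 1 := fun x => by
      split_ifs
      · exact coe_rootI
      · rfl
    simp only [e] at h
    exact mul_right_cancel₀ hne (h.symm.trans (one_mul _).symm)
  by_cases hij : i = j
  · subst hij
    have hkl : k ≠ l := fun h => h1 ⟨rfl, h⟩
    have := key l
    simp only [if_neg hkl, if_true] at this
    split_ifs at this <;> simp [Complex.ext_iff] at this
  · by_cases hik : i = k
    · subst hik
      have hjl : j ≠ l := fun h => h2 ⟨rfl, h⟩
      have := key l
      simp only [if_neg hjl, if_true] at this
      split_ifs at this <;> simp [Complex.ext_iff] at this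
    · -- The exponent of the phase of `i` is `1` or `2`.
      have := key i
      simp only [if_neg (Ne.symm hij), if_neg (Ne.symm hik), if_true] at this
      split_ifs at this <;> norm_num [Complex.ext_iff] at this

/-- The orbit average of a pure state whose coefficient matrix `A` satisfies
`(d + 1) ∑ |A i i|² = 1 + |tr A|²` is isotropic. -/
theorem twirl_eq_isotropicState {d : ℕ} (hd : 2 ≤ d) {b : ℝ} {A : Matrix (Fin d) (Fin d) ℂ}
    (hA : ∑ i, ∑ j, ‖A i j‖ ^ 2 = 1) (htr : ‖A.trace‖ ^ 2 = d * b)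
    (hdiag : ∑ i, ‖A i i‖ ^ 2 = (1 + d * b) / (d + 1)) :
    (1 / (Fintype.card (TwirlIndex d) : ℝ)) • twirlSum A = isotropicState d b := by
  have hN : ((Fintype.card (TwirlIndex d) : ℝ) : ℂ) ≠ 0 := by
    exact_mod_cast Fintype.card_ne_zero
  have hsmul : ∀ x y, ((1 / (Fintype.card (TwirlIndex d) : ℝ)) • twirlSum A) x y =
      1 / ((Fintype.card (TwirlIndex d) : ℝ) : ℂ) * twirlSum A x y := fun x y => by
    simp [Matrix.smul_apply, Complex.real_smul]
  -- A sum of entries of the twirl is the average of the corresponding sums over the orbit.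
  have havg : ∀ {f : TwirlIndex d → ℂ} {v : ℂ}, (∀ g, f g = v) →
      1 / ((Fintype.card (TwirlIndex d) : ℝ) : ℂ) * ∑ g, f g = v := fun h => by
    rw [Finset.sum_congr rfl fun g _ => h g, Finset.sum_const, nsmul_eq_mul, Finset.card_univ]
    push_cast at hN ⊢
    field_simp
  refine eq_isotropicState_of_invariant hd _ ?_ ?_ ?_ ?_ ?_
  · intro i j k l h1 h2
    rw [hsmul, twirlSum_eq_zero A i j k l h1 h2, mul_zero]
  · intro σ i j k l
    rw [hsmul, hsmul, twirlSum_perm]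
  · simp only [hsmul, twirlSum_apply, ← Finset.mul_sum]
    rw [Finset.sum_congr rfl fun i _ => Finset.sum_comm, Finset.sum_comm]
    refine havg fun g => ?_
    have := (mem_unitVecs_iff _).1 (vecOfMatrix_twirlMatrix_mem_unitVecs hA g)
    rw [coeffMatrix_vecOfMatrix] at this
    simp only [Complex.star_def, Complex.mul_conj']
    exact_mod_cast congrArg Complex.ofReal this
  · simp only [hsmul, twirlSum_apply, ← Finset.mul_sum]
    rw [Finset.sum_congr rfl fun i _ => Finset.sum_comm, Finset.sum_comm]
    refine havg fun g => ?_
    rw [← Finset.sum_mul_sum, ← star_sum]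
    simp only [twirlMatrix_apply_self]
    rw [Equiv.sum_comp g.2 fun i => A i i]
    change A.trace * star A.trace = _
    rw [Complex.star_def, Complex.mul_conj']
    exact_mod_cast congrArg Complex.ofReal htr
  · simp only [hsmul, twirlSum_apply, ← Finset.mul_sum]
    rw [Finset.sum_comm]
    refine havg fun g => ?_
    simp only [twirlMatrix_apply_self, Complex.star_def, Complex.mul_conj']
    rw [Equiv.sum_comp g.2 fun i => (‖A i i‖ : ℂ) ^ 2]
    exact_mod_cast congrArg Complex.ofReal hdiag

/-- The twirl of a vector of Schmidt rank below `k` has a decomposition into such vectors. -/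
theorem isotropicState_mem_roofHull {d k : ℕ} (hd : 2 ≤ d) {b : ℝ} {A : Matrix (Fin d) (Fin d) ℂ}
    (hA : ∑ i, ∑ j, ‖A i j‖ ^ 2 = 1) (htr : ‖A.trace‖ ^ 2 = d * b)
    (hdiag : ∑ i, ‖A i i‖ ^ 2 = (1 + d * b) / (d + 1)) (hrank : A.rank < k) :
    (isotropicState d b, (0 : ℝ)) ∈ roofHull (genConcurrence d k) := by
  have hN : (Fintype.card (TwirlIndex d) : ℝ) ≠ 0 := by exact_mod_cast Fintype.card_ne_zero
  refine mem_convexHull_of_exists_fintype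
    (fun _ : TwirlIndex d => 1 / (Fintype.card (TwirlIndex d) : ℝ))
    (fun g => (ketBra (vecOfMatrix (twirlMatrix A g)), 0)) (fun _ => by positivity) ?_ ?_ ?_
  · rw [Finset.sum_const, nsmul_eq_mul, Finset.card_univ, mul_one_div_cancel hN]
  · intro g
    refine ⟨_, vecOfMatrix_twirlMatrix_mem_unitVecs hA g, Prod.ext rfl ?_⟩
    exact genConcurrence_eq_zero_of_rank_lt ((rank_twirlMatrix_le A g).trans_lt hrank)
  · rw [← twirl_eq_isotropicState hd hA htr hdiag, ← Finset.smul_sum, twirlSum]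
    refine Prod.ext ?_ ?_
    · simp [Prod.fst_sum]
    · simp [Prod.snd_sum]

/-! ### Decompositions at the kinks of the convex roofs -/

theorem exists_orthogonal_unit_sum_sq_mul_sq {d : ℕ} (hd : 2 ≤ d) :
    ∃ v w : Fin d → ℝ, ∑ i, v i ^ 2 = 1 ∧ ∑ i, w i ^ 2 = 1 ∧ ∑ i, v i * w i = 0 ∧
      ∑ i, v i ^ 2 * w i ^ 2 = 1 / (d + 1) := by
  obtain ⟨n, rfl⟩ := Nat.exists_eq_add_of_le' hd
  -- `v = (c, s, 0, …)` and `w = (-s, c, 0, …)` with `c² + s² = 1` and `2 c² s² = 1 / (d + 1)`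
  set q : ℝ := √((n + 1) / (n + 3)) with hq
  have hq2 : q ^ 2 = (n + 1) / (n + 3) := Real.sq_sqrt (by positivity)
  have hq0 : 0 ≤ q := Real.sqrt_nonneg _
  have hq1 : q ≤ 1 := by
    rw [← sq_le_one_iff₀ hq0, hq2, div_le_one (by positivity)]
    linarith
  have hc : √((1 + q) / 2) ^ 2 = (1 + q) / 2 := Real.sq_sqrt (by linarith)
  have hs : √((1 - q) / 2) ^ 2 = (1 - q) / 2 := Real.sq_sqrt (by linarith)
  set c := √((1 + q) / 2)
  set s := √((1 - q) / 2)
  refine ⟨Fin.cons c (Fin.cons s 0), Fin.cons (-s) (Fin.cons c 0), ?_, ?_, ?_, ?_⟩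
  · simp [Fin.sum_univ_succ, hc, hs]
    ring
  · simp [Fin.sum_univ_succ, hc, hs]
    ring
  · simp [Fin.sum_univ_succ]
    ring
  · simp [Fin.sum_univ_succ, hc, hs]
    have : (1 + q) / 2 * ((1 - q) / 2) + (1 - q) / 2 * ((1 + q) / 2) = (1 - q ^ 2) / 2 := by ring
    rw [this, hq2]
    field_simp
    ring

theorem exists_unit_sum_pow_four {d : ℕ} (hd : 2 ≤ d) :
    ∃ v : Fin d → ℝ, ∑ i, v i ^ 2 = 1 ∧ ∑ i, v i ^ 4 = 2 / (d + 1) := by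
  obtain ⟨n, rfl⟩ := Nat.exists_eq_add_of_le' hd
  -- `v = (x, y, …, y)`, where `x² = p` is the larger root of `p² + (1 - p)² / (d - 1) = 2 / (d + 1)`
  set r : ℝ := √(n + 3) with hr
  have hr2 : r ^ 2 = n + 3 := Real.sq_sqrt (by positivity)
  have hr1 : 1 ≤ r := by rw [hr, Real.one_le_sqrt]; linarith [(Nat.cast_nonneg n : (0 : ℝ) ≤ n)]
  set p : ℝ := (1 + (n + 1) / r) / (n + 2) with hp
  have hp0 : 0 ≤ p := by positivity
  have hp1 : p ≤ 1 := by
    rw [hp, div_le_one (by positivity)]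
    have : (n + 1 : ℝ) / r ≤ n + 1 := div_le_self (by positivity) hr1
    linarith
  have hx : √p ^ 2 = p := Real.sq_sqrt hp0
  have hy : √((1 - p) / (n + 1)) ^ 2 = (1 - p) / (n + 1) :=
    Real.sq_sqrt (div_nonneg (by linarith) (by positivity))
  refine ⟨Fin.cons √p fun _ => √((1 - p) / (n + 1)), ?_, ?_⟩
  · rw [Fin.sum_univ_succ]
    simp only [Fin.cons_zero, Fin.cons_succ, hx, hy, Finset.sum_const, Finset.card_univ,
      Fintype.card_fin, nsmul_eq_mul]
    push_cast
    field_simp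
    ring
  · have h4 : ∀ z : ℝ, z ^ 4 = (z ^ 2) ^ 2 := fun z => by ring
    rw [Fin.sum_univ_succ]
    simp only [Fin.cons_zero, Fin.cons_succ, h4, hx, hy, Finset.sum_const, Finset.card_univ,
      Fintype.card_fin, nsmul_eq_mul]
    push_cast
    have hquad : (n + 2 : ℝ) * p = 1 + (n + 1) / r := by rw [hp]; field_simp
    have hsq : ((n + 2 : ℝ) * p - 1) ^ 2 * (n + 3) = (n + 1) ^ 2 := by
      rw [hquad, ← hr2]; field_simp; ring
    have hn2 : (n + 2 : ℝ) ≠ 0 := by positivity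
    field_simp
    refine mul_left_cancel₀ hn2 ?_
    linear_combination hsq

/-- The twirl of the real product vector `v ⊗ w`. -/
theorem isotropicState_mem_roofHull_of_product {d k : ℕ} (hd : 2 ≤ d) (hk : 2 ≤ k) {b : ℝ}
    {v w : Fin d → ℝ} (hv : ∑ i, v i ^ 2 = 1) (hw : ∑ i, w i ^ 2 = 1)
    (htr : (∑ i, v i * w i) ^ 2 = d * b)
    (hdiag : ∑ i, v i ^ 2 * w i ^ 2 = (1 + d * b) / (d + 1)) :
    (isotropicState d b, (0 : ℝ)) ∈ roofHull (genConcurrence d k) := by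
  have hnorm : ∀ i j, ‖Matrix.vecMulVec (fun i => (v i : ℂ)) (fun j => (w j : ℂ)) i j‖ ^ 2 =
      v i ^ 2 * w j ^ 2 := fun i j => by
    rw [Matrix.vecMulVec_apply, norm_mul, Complex.norm_real, Complex.norm_real, mul_pow,
      Real.norm_eq_abs, Real.norm_eq_abs, sq_abs, sq_abs]
  refine isotropicState_mem_roofHull hd
    (A := Matrix.vecMulVec (fun i => (v i : ℂ)) (fun j => (w j : ℂ))) ?_ ?_ ?_
    ((Matrix.rank_vecMulVec_le _ _).trans_lt hk)
  · simp only [hnorm, ← Finset.mul_sum, hw, mul_one, hv]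
  · have : (Matrix.vecMulVec (fun i => (v i : ℂ)) (fun j => (w j : ℂ))).trace =
        ((∑ i, v i * w i : ℝ) : ℂ) := by
      simp [Matrix.trace, Matrix.vecMulVec_apply]
    rw [this, Complex.norm_real, Real.norm_eq_abs, sq_abs, htr]
  · simp only [hnorm, hdiag]

theorem isotropicState_zero_mem_roofHull {d k : ℕ} (hd : 2 ≤ d) (hk : 2 ≤ k) :
    (isotropicState d 0, (0 : ℝ)) ∈ roofHull (genConcurrence d k) := by
  obtain ⟨v, w, hv, hw, hvw, h4⟩ := exists_orthogonal_unit_sum_sq_mul_sq hd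
  exact isotropicState_mem_roofHull_of_product hd hk hv hw (by rw [hvw]; ring) (by rw [h4]; ring)

theorem isotropicState_one_div_mem_roofHull {d k : ℕ} (hd : 2 ≤ d) (hk : 2 ≤ k) :
    (isotropicState d (1 / d), (0 : ℝ)) ∈ roofHull (genConcurrence d k) := by
  have hd0 : (d : ℝ) ≠ 0 := by exact_mod_cast (by omega : d ≠ 0)
  obtain ⟨v, hv, h4⟩ := exists_unit_sum_pow_four hd
  refine isotropicState_mem_roofHull_of_product hd hk hv hv ?_ ?_
  · simp only [← sq, hv]
    field_simp
  · simp only [← pow_add, h4, mul_one_div_cancel hd0]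
    norm_num

theorem Matrix.rank_lt_of_mulVec_eq_zero {d : ℕ} {A : Matrix (Fin d) (Fin d) ℂ} {v : Fin d → ℂ}
    (hv : v ≠ 0) (h : A.mulVec v = 0) : A.rank < d := by
  have h1 := A.mulVecLin.finrank_range_add_finrank_ker
  rw [Module.finrank_fin_fun] at h1
  have : Nontrivial (LinearMap.ker A.mulVecLin) :=
    ⟨⟨⟨v, h⟩, 0, fun h0 => hv (congrArg Subtype.val h0)⟩⟩
  have h2 : 0 < Module.finrank ℂ (LinearMap.ker A.mulVecLin) := Module.finrank_pos
  rw [Matrix.rank]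
  omega

/-- At `b = 1 - 1 / d` the coefficient matrix of the twirled vector is a normalized projection
`1 - v vᵀ` of rank `d - 1`. -/
theorem isotropicState_one_sub_one_div_mem_roofHull {d : ℕ} (hd : 2 ≤ d) :
    (isotropicState d (1 - 1 / d), (0 : ℝ)) ∈ roofHull (genConcurrence d d) := by
  have hd' : (2 : ℝ) ≤ d := by exact_mod_cast hd
  have hd1 : (0 : ℝ) < d - 1 := by linarith
  obtain ⟨v, hv, h4⟩ := exists_unit_sum_pow_four hd
  let R : Fin d → Fin d → ℝ := fun i j => ((if i = j then 1 else 0) - v i * v j) / √(d - 1)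
  have hR2 : ∀ i j, R i j ^ 2 =
      ((if i = j then 1 - 2 * v i ^ 2 else 0) + v i ^ 2 * v j ^ 2) / (d - 1) := fun i j => by
    simp only [R]
    rw [div_pow, Real.sq_sqrt hd1.le]
    split_ifs with h
    · rw [h]; ring
    · ring
  have hnorm : ∀ i j, ‖(Matrix.of fun i j => (R i j : ℂ)) i j‖ ^ 2 = R i j ^ 2 := fun i j => by
    rw [Matrix.of_apply, Complex.norm_real, Real.norm_eq_abs, sq_abs]
  refine isotropicState_mem_roofHull hd (A := Matrix.of fun i j => (R i j : ℂ)) ?_ ?_ ?_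
    (Matrix.rank_lt_of_mulVec_eq_zero (v := fun i => (v i : ℂ)) ?_ ?_)
  · simp only [hnorm, hR2, ← Finset.sum_div, Finset.sum_add_distrib, ← Finset.mul_sum, hv,
      Finset.sum_ite_eq, Finset.mem_univ, if_true, Finset.sum_sub_distrib, Finset.sum_const,
      Finset.card_univ, Fintype.card_fin, nsmul_eq_mul, mul_one]
    field_simp
    ring
  · have : (Matrix.of fun i j => (R i j : ℂ)).trace = ((√(d - 1) : ℝ) : ℂ) := by
      have h : ∑ i, R i i = √(d - 1) := by
        simp only [R, if_true, ← Finset.sum_div, Finset.sum_sub_distrib, ← sq, hv,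
          Finset.sum_const, Finset.card_univ, Fintype.card_fin, nsmul_eq_mul, mul_one]
        exact Real.div_sqrt
      rw [← h]
      simp [Matrix.trace]
    rw [this, Complex.norm_real, Real.norm_eq_abs, sq_abs, Real.sq_sqrt hd1.le]
    field_simp
  · simp only [hnorm, hR2, if_true, ← Finset.sum_div, Finset.sum_add_distrib,
      Finset.sum_sub_distrib, ← Finset.mul_sum, hv, ← pow_add, h4, Finset.sum_const,
      Finset.card_univ, Fintype.card_fin, nsmul_eq_mul]
    norm_num [h4]
    field_simp
    ring
  · intro h0
    have : ∀ i, v i = 0 := fun i => by simpa using congrFun h0 i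
    simp [this] at hv
  · funext i
    have h : ∑ j, R i j * v j = 0 := by
      have : ∀ j, R i j * v j =
          ((if i = j then v j else 0) - v i * v j ^ 2) / √(d - 1) := fun j => by
        simp only [R]
        split_ifs <;> ring
      simp only [this, ← Finset.sum_div, Finset.sum_sub_distrib, ← Finset.mul_sum, hv,
        Finset.sum_ite_eq, Finset.mem_univ, if_true, mul_one, sub_self, zero_div]
    simp only [Matrix.mulVec, dotProduct, Matrix.of_apply, Pi.zero_apply]
    exact_mod_cast congrArg Complex.ofReal h

theorem isotropicState_one_mem_roofHull {d k : ℕ} (hk : 0 < k) (hkd : k ≤ d) :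
    (isotropicState d 1, (1 : ℝ)) ∈ roofHull (genConcurrence d k) := by
  refine subset_convexHull ℝ _ ⟨maxEntVec d, maxEntVec_mem_unitVecs (hk.trans_le hkd), ?_⟩
  refine Prod.ext ?_ (genConcurrence_maxEntVec hk hkd)
  simp [ketBra_maxEntVec, isotropicState]

/-! ### The convex roofs of the concurrences -/

theorem roofs_genConcurrence_eq_zero {d k : ℕ} (hd : 2 ≤ d) (hk : 2 ≤ k) {b₁ b : ℝ}
    (h₁ : (isotropicState d b₁, (0 : ℝ)) ∈ roofHull (genConcurrence d k))
    (hb : b ∈ Set.Icc 0 b₁) :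
    stateRoof (genConcurrence d k) (isotropicState d b) = 0 ∧
      isoMinRoof (genConcurrence d k) b = 0 := by
  have h := roofs_eq_of_mem_roofHull (m := 0) (c := 0) hd (genConcurrence_nonneg k)
    (fun ψ _ => by simpa using genConcurrence_nonneg k ψ)
    (isotropicState_mem_roofHull_of_mem_Icc
      (by simpa using isotropicState_zero_mem_roofHull hd hk) (by simpa using h₁) hb)
  simpa using h

/-- Above the kink `b₀` both convex roofs are the affine function that vanishes at `b₀` and is `1`
at `1`. -/
theorem roofs_genConcurrence_eq_affine {d k : ℕ} (hd : 2 ≤ d) (hk : 0 < k) (hkd : k ≤ d)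
    {m c b₀ b : ℝ} (h : ∀ ψ ∈ unitVecs d, m * traceOverlap ψ + c ≤ genConcurrence d k ψ)
    (h₀ : (isotropicState d b₀, (0 : ℝ)) ∈ roofHull (genConcurrence d k))
    (hm₀ : m * b₀ + c = 0) (hm₁ : m * 1 + c = 1) (hb : b ∈ Set.Icc b₀ 1) :
    stateRoof (genConcurrence d k) (isotropicState d b) = ((m * b + c : ℝ) : EReal) ∧
      isoMinRoof (genConcurrence d k) b = ((m * b + c : ℝ) : EReal) :=
  roofs_eq_of_mem_roofHull hd (genConcurrence_nonneg k) h
    (isotropicState_mem_roofHull_of_mem_Icc (by rwa [hm₀])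
      (by rw [hm₁]; exact isotropicState_one_mem_roofHull hk hkd) hb)

theorem mainTheorem11 (d : ℕ) (hd : 2 ≤ d) (b : ℝ) (hb : b ∈ Set.Icc (0 : ℝ) 1) :
    -- the 2-concurrence
    ((b ≤ 1 / (d : ℝ) →
        stateRoof (genConcurrence d 2) (isotropicState d b) = 0 ∧
        isoMinRoof (genConcurrence d 2) b = 0) ∧
      (1 / (d : ℝ) ≤ b →
        stateRoof (genConcurrence d 2) (isotropicState d b) =
          ((((d : ℝ) * b - 1) / ((d : ℝ) - 1) : ℝ) : EReal) ∧
        isoMinRoof (genConcurrence d 2) b =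
          ((((d : ℝ) * b - 1) / ((d : ℝ) - 1) : ℝ) : EReal))) ∧
    -- the G-concurrence
    ((b ≤ 1 - 1 / (d : ℝ) →
        stateRoof (genConcurrence d d) (isotropicState d b) = 0 ∧
        isoMinRoof (genConcurrence d d) b = 0) ∧
      (1 - 1 / (d : ℝ) ≤ b →
        stateRoof (genConcurrence d d) (isotropicState d b) =
          (((d : ℝ) * b - (d : ℝ) + 1 : ℝ) : EReal) ∧
        isoMinRoof (genConcurrence d d) b =
          (((d : ℝ) * b - (d : ℝ) + 1 : ℝ) : EReal))) := by
  have hd' : (2 : ℝ) ≤ d := by exact_mod_cast hd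
  have hd1 : (d : ℝ) - 1 ≠ 0 := by linarith
  refine ⟨⟨fun h => ?_, fun h => ?_⟩, ⟨fun h => ?_, fun h => ?_⟩⟩
  · exact roofs_genConcurrence_eq_zero hd le_rfl (isotropicState_one_div_mem_roofHull hd le_rfl)
      ⟨hb.1, h⟩
  · have e : ∀ x : ℝ, (d * x - 1) / (d - 1) = d / (d - 1) * x + -1 / (d - 1) := fun x => by ring
    rw [e]
    refine roofs_genConcurrence_eq_affine hd two_pos hd (fun ψ hψ => ?_)
      (isotropicState_one_div_mem_roofHull hd le_rfl) ?_ ?_ ⟨h, hb.2⟩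
    · rw [← e]
      exact le_genConcurrence_two hd hψ
    · field_simp
      ring
    · field_simp
      ring
  · exact roofs_genConcurrence_eq_zero hd hd (isotropicState_one_sub_one_div_mem_roofHull hd)
      ⟨hb.1, h⟩
  · have e : ∀ x : ℝ, d * x - d + 1 = d * x + (1 - d) := fun x => by ring
    rw [e]
    refine roofs_genConcurrence_eq_affine hd (by omega) le_rfl (fun ψ hψ => ?_)
      (isotropicState_one_sub_one_div_mem_roofHull hd) ?_ ?_ ⟨h, hb.2⟩
    · rw [← e]
      exact le_genConcurrence_self (by omega) hψ
    · field_simp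
      ring
    · ring
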